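/- Let $\mathcal A\subset\mathbb Z^2$ be the set of all lattice points of a two-dimensional lattice polygon (for instance a 2-face of a reflexive polytope, written in a lattice basis of its plane); that is, $\mathcal A$ is finite, affinely spans $\mathbb R^2$, and $\mathcal A=\mathrm{conv}(\mathcal A)\cap\mathbb Z^2$. A height vector $h\in\mathbb R^{\mathcal A}$ lifts each $p\in\mathcal A$ to $\tilde p=(p,h_p)\in\mathbb R^3$. A triangulation of $\mathcal A$ is a simplicial complex covering $\mathrm{conv}(\mathcal A)$ with vertices in $\mathcal A$; it is fine if every point of $\mathcal A$ is a vertex. The vector $h$ generates the triangulation $\mathcal T$ if the simplices of $\mathcal T$ are exactly the projections to $\mathbb R^2$ of the lower faces of $\mathrm{conv}\{\tilde p : p\in\mathcal A\}$ (those with an outward normal having negative last component), and $\mathcal T$ is regular if some $h$ generates it. The secondary cone of a regular triangulation $\mathcal T$ is the closure in $\mathbb R^{\mathcal A}$ of the set of height vectors generating $\mathcal T$. Let $U\subseteq\mathbb R^{\mathcal A}$ be the support of the secondary subfan of fine regular triangulations, i.e. the union of the secondary cones of all fine regular triangulations of $\mathcal A$. Let $H\subset\mathbb R^{\mathcal A}$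 be the finite set consisting of the normal vectors of the following constraints: - (linear) $h_i+h_j-2h_r\ge 0$, for all distinct $p_i,p_j\in\mathcal A$ such that $p_r$ is the only lattice point in the relative interior of the segment $\mathrm{conv}\{p_i,p_j\}$; - (planar) $h_i+h_j+h_k-3h_r\ge 0$, for all $p_i,p_j,p_k\in\mathcal A$ that span a non-degenerate triangle such that $p_r$ is the only lattice point in its interior and the vertices are the only lattice points on its boundary. For $S\subset\mathbb R^{\mathcal A}$ write $\mathrm{coni}(S)$ for the conical hull of $S$, and $\mathrm{coni}(S)^*=\{h : n\cdot h\ge 0\text{ for all } n\in \mathrm{coni}(S)\}$ for its dual cone. Then $$\mathrm{coni}(H)^*=U .$$ Moreover, for every finite set $G\subset\mathbb R^{\mathcal A}$ of hyperplane normals defining $U$, i.e. with $\mathrm{coni}(G)^*=U$, one has $\mathrm{coni}(G)=\mathrm{coni}(H)$. -/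

import Mathlib

noncomputable section

namespace FineSecondary

/-- The plane in which the point configurations live. -/
abbrev Plane : Type := Fin 2 → ℝ

/-- A lattice point of `ℤ²`, seen as a point of `ℝ²`. -/
def toPlane (p : Fin 2 → ℤ) : Plane := fun i => (p i : ℝ)

/-- The polygon `conv(A)`. -/
def polygon (A : Finset (Fin 2 → ℤ)) : Set Plane :=
  convexHull ℝ (toPlane '' (A : Set (Fin 2 → ℤ)))

/-- `A` is the set of all lattice points of a (two-dimensional) lattice polygon: it is
full-dimensional and contains every lattice point of its convex hull. -/
structure IsLatticePolygon (A : Finset (Fin 2 → ℤ)) : Prop where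
  affineSpan_eq_top : affineSpan ℝ (toPlane '' (A : Set (Fin 2 → ℤ))) = ⊤
  mem_of_mem_polygon : ∀ p : Fin 2 → ℤ, toPlane p ∈ polygon A → p ∈ A

/-- Height vectors on the configuration `A`. -/
abbrev Height (A : Finset (Fin 2 → ℤ)) : Type := A → ℝ

/-- The dual cone `{h | 0 ≤ n · h for all n ∈ S}` of a set `S` of (hyperplane normal) vectors,
with respect to the standard pairing of `ℝ^A` with itself. -/
def dualCone {A : Finset (Fin 2 → ℤ)} (S : Set (Height A)) : Set (Height A) :=
  {h | ∀ n ∈ S, 0 ≤ n ⬝ᵥ h}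

/-! ### Lower faces and regular triangulations -/

/-- The convex hull in `ℝ² × ℝ` of the lifted points `(p, h p)`. -/
def liftedHull (A : Finset (Fin 2 → ℤ)) (h : Height A) : Set (Plane × ℝ) :=
  convexHull ℝ (Set.range fun p : A => (toPlane p, h p))

/-- The lower face of the lifted hull whose points minimise `(x, t) ↦ a · x + t`, that is, the
face with outward normal `(-a, -1)`. -/
def lowerFace (A : Finset (Fin 2 → ℤ)) (h : Height A) (a : Plane) : Set (Plane × ℝ) :=
  {z ∈ liftedHull A h | ∀ w ∈ liftedHull A h, a ⬝ᵥ z.1 + z.2 ≤ a ⬝ᵥ w.1 + w.2}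

/-- A fine triangulation of `A`: a simplicial complex that covers `conv(A)` and whose vertices are
exactly the points of `A`. -/
structure IsFineTriangulation (A : Finset (Fin 2 → ℤ))
    (K : Geometry.SimplicialComplex ℝ Plane) : Prop where
  space_eq : K.space = polygon A
  vertices_eq : K.vertices = toPlane '' (A : Set (Fin 2 → ℤ))

/-- The height vector `h` generates `K`: the simplices of `K` (of all dimensions) are exactly the
projections to the plane of the lower faces (of all dimensions) of the lifted hull. -/
def Generates (A : Finset (Fin 2 → ℤ)) (h : Height A)
    (K : Geometry.SimplicialComplex ℝ Plane) : Prop :=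
  (fun s : Finset Plane => convexHull ℝ (s : Set Plane)) '' K.faces =
    Set.range fun a : Plane => Prod.fst '' lowerFace A h a

/-- A fine regular triangulation of `A`. -/
def IsFineRegularTriangulation (A : Finset (Fin 2 → ℤ))
    (K : Geometry.SimplicialComplex ℝ Plane) : Prop :=
  IsFineTriangulation A K ∧ ∃ h : Height A, Generates A h K

/-- The secondary cone of a triangulation: the closed cone obtained as the closure of the set of
height vectors that generate it. -/
def secondaryCone (A : Finset (Fin 2 → ℤ)) (K : Geometry.SimplicialComplex ℝ Plane) :
    Set (Height A) :=
  closure {h | Generates A h K}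

/-- The support of the secondary subfan of fine triangulations: the union of the secondary cones of
all fine regular triangulations of `A`. -/
def fineSubfanSupport (A : Finset (Fin 2 → ℤ)) : Set (Height A) :=
  ⋃ K ∈ {K : Geometry.SimplicialComplex ℝ Plane | IsFineRegularTriangulation A K},
    secondaryCone A K

/-! ### Linear and planar constraints -/

/-- `r` is the only point of `A` in the relative interior of the segment with distinct endpoints
`i`, `j`. -/
def IsLinearCircuit {A : Finset (Fin 2 → ℤ)} (i j r : A) : Prop :=
  i ≠ j ∧ ∀ q : A, toPlane q ∈ openSegment ℝ (toPlane i) (toPlane j) ↔ q = r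

/-- `r` lies in the interior of the (non-degenerate) triangle `i j k`, and `i`, `j`, `k`, `r` are
the only points of `A` in that triangle. -/
def IsPlanarCircuit {A : Finset (Fin 2 → ℤ)} (i j k r : A) : Prop :=
  toPlane r ∈ interior (convexHull ℝ {toPlane i, toPlane j, toPlane k}) ∧
    ∀ q : A, toPlane q ∈ convexHull ℝ {toPlane i, toPlane j, toPlane k} →
      q = i ∨ q = j ∨ q = k ∨ q = r

/-- The normal vector of the constraint `h i + h j - 2 h r ≥ 0`. -/
def linearNormal {A : Finset (Fin 2 → ℤ)} (i j r : A) : Height A :=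
  Pi.single i 1 + Pi.single j 1 - Pi.single r 2

/-- The normal vector of the constraint `h i + h j + h k - 3 h r ≥ 0`. -/
def planarNormal {A : Finset (Fin 2 → ℤ)} (i j k r : A) : Height A :=
  Pi.single i 1 + Pi.single j 1 + Pi.single k 1 - Pi.single r 3

/-- The normal vectors of all linear and planar constraints of `A`. -/
def constraintNormals (A : Finset (Fin 2 → ℤ)) : Set (Height A) :=
  {n | ∃ i j r : A, IsLinearCircuit i j r ∧ n = linearNormal i j r} ∪
    {n | ∃ i j k r : A, IsPlanarCircuit i j k r ∧ n = planarNormal i j k r}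

end FineSecondary

end

/-! For a slope `a`, the points of `A` minimising `a · p + h p` form a contact set, and the lower
faces project onto the convex hulls of contact sets. All of regularity is phrased through them.

The support lies in the dual cone: if `h` generates a fine triangulation, every `r` is the unique
minimiser for some slope. The centre of a circuit is the average of its outer points: for a segment
by reflecting the centre, for a triangle because an empty lattice triangle spans the lattice. An
affine tilt thus cancels from each constraint, which holds strictly
(`constraintNormals_dotProduct_pos`).

Conversely, let all constraints hold strictly. If the hull of a contact set contained a lattice
point outside that set, one of maximal tilted height would, by `hasCircuitIn_convexHull`, be the
centre of a circuit in the same hull, against maximality (`mem_contact_of_mem_convexHull`). For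
generic `h` contact sets are affinely independent and form a triangulation, which is therefore fine.
There are finitely many triangulations, so the support is closed; it then contains all strict
solutions by density, and all weak ones by perturbing with the paraboloid `p ↦ p · p`.

The paraboloid also makes the dual cone full-dimensional. The bipolar theorem for finitely generated
cones, `mem_hull_of_forall_dualCone`, recovers the conical hull from the dual cone, whence the
statement about `G`. -/

noncomputable section

namespace FineSecondary

open Finset Topology Filter

/-! ### Convex combinations and affine interpolation -/

/-- A point of the convex hull of a finite family is a convex combination of the family. -/
theorem mem_convexHull_image_iff {ι E : Type*} [Fintype ι] [AddCommGroup E] [Module ℝ E]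
    (v : ι → E) (F : Set ι) (x : E) :
    x ∈ convexHull ℝ (v '' F) ↔
      ∃ w : ι → ℝ, (∀ i, 0 ≤ w i) ∧ (∀ i, i ∉ F → w i = 0) ∧ ∑ i, w i = 1 ∧
        ∑ i, w i • v i = x := by
  classical
  constructor
  · intro hx
    have hconv : Convex ℝ {x : E | ∃ w : ι → ℝ, (∀ i, 0 ≤ w i) ∧ (∀ i, i ∉ F → w i = 0) ∧
        ∑ i, w i = 1 ∧ ∑ i, w i • v i = x} := by
      rintro x ⟨w, hw0, hwF, hw1, rfl⟩ y ⟨w', hw0', hwF', hw1', rfl⟩ s t hs ht hst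
      refine ⟨fun i => s * w i + t * w' i, fun i => ?_, fun i hi => ?_, ?_, ?_⟩
      · have := hw0 i; have := hw0' i; positivity
      · simp [hwF i hi, hwF' i hi]
      · rw [sum_add_distrib, ← mul_sum, ← mul_sum, hw1, hw1', mul_one, mul_one, hst]
      · simp only [add_smul, mul_smul, sum_add_distrib, smul_sum]
    refine convexHull_min ?_ hconv hx
    rintro _ ⟨i, hi, rfl⟩
    refine ⟨Pi.single i 1, fun j => ?_, fun j hj => ?_, ?_, ?_⟩
    · by_cases h : j = i
      · subst h; simp
      · simp [h]
    · rw [Pi.single_eq_of_ne]; rintro rfl; exact hj hi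
    · simp
    · simp [Pi.single_apply, ite_smul]
  · rintro ⟨w, hw0, hwF, hw1, rfl⟩
    have h1 : ∑ i with i ∈ F, w i = 1 := by
      rw [← hw1, sum_filter]
      exact sum_congr rfl fun i _ => by by_cases h : i ∈ F <;> simp [h, hwF]
    have h2 : ∑ i, w i • v i = ∑ i with i ∈ F, w i • v i := by
      rw [sum_filter]
      exact sum_congr rfl fun i _ => by by_cases h : i ∈ F <;> simp [h, hwF]
    rw [h2]
    exact (convex_convexHull ℝ _).sum_mem (fun i _ => hw0 i) h1
      fun i hi => subset_convexHull ℝ _ ⟨i, by simpa using hi, rfl⟩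

/-- Affine functions interpolate arbitrary values on an affinely independent family. -/
theorem exists_affine_interpolation {ι : Type*} [Fintype ι] {z : ι → Plane}
    (hz : AffineIndependent ℝ z) (f : ι → ℝ) :
    ∃ (b : Plane) (c : ℝ), ∀ i, b ⬝ᵥ z i + c = f i := by
  classical
  let T : Plane × ℝ →ₗ[ℝ] (ι → ℝ) :=
    { toFun := fun y i => y.1 ⬝ᵥ z i + y.2
      map_add' := fun y y' => by
        ext i; simp only [Prod.fst_add, Prod.snd_add, add_dotProduct, Pi.add_apply]; ring
      map_smul' := fun s y => by
        ext i
        simp only [Prod.smul_fst, Prod.smul_snd, smul_dotProduct, Pi.smul_apply, smul_eq_mul,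
          RingHom.id_apply]
        ring }
  suffices h : LinearMap.range T = ⊤ by
    obtain ⟨y, hy⟩ := LinearMap.range_eq_top.1 h f
    exact ⟨y.1, y.2, fun i => congrFun hy i⟩
  by_contra hne
  -- A functional vanishing on a proper range would be an affine dependence of `z`.
  obtain ⟨g, hg0, hg⟩ := Submodule.exists_le_ker_of_lt_top _ (lt_top_iff_ne_top.2 hne)
  apply hg0
  set μ : ι → ℝ := fun i => g (Pi.single i 1) with hμ
  have hgμ : ∀ y : ι → ℝ, g y = ∑ i, μ i * y i := by
    intro y
    conv_lhs => rw [pi_eq_sum_univ' y]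
    rw [map_sum]
    refine sum_congr rfl fun i _ => ?_
    rw [map_smul, smul_eq_mul, mul_comm, hμ]
  have hT : ∀ (b : Plane) (c : ℝ), ∑ i, μ i * (b ⬝ᵥ z i + c) = 0 := by
    intro b c
    change ∑ i, μ i * T (b, c) i = 0
    rw [← hgμ (T (b, c))]
    exact hg ⟨(b, c), rfl⟩
  have h1 : ∑ i, μ i = 0 := by simpa using hT 0 1
  have h2 : ∑ i, μ i • z i = 0 := by
    ext k
    have := hT (Pi.single k 1) 0
    simpa [single_dotProduct] using this
  have := (affineIndependent_iff.1 hz) univ μ h1 h2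
  ext i
  simp only [LinearMap.coe_comp, LinearMap.coe_single, Function.comp_apply, LinearMap.zero_comp,
    LinearMap.zero_apply]
  exact this i (mem_univ i)

/-! ### Contact sets of a height function -/

section Contact

variable {ι : Type*} [Fintype ι]

open Classical in
/-- The indices at which the tilted height function `i ↦ a · z i + h i` is minimal. -/
def contact (z : ι → Plane) (h : ι → ℝ) (a : Plane) : Finset ι :=
  {i | ∀ j, a ⬝ᵥ z i + h i ≤ a ⬝ᵥ z j + h j}

theorem mem_contact {z : ι → Plane} {h : ι → ℝ} {a : Plane} {i : ι} :
    i ∈ contact z h a ↔ ∀ j, a ⬝ᵥ z i + h i ≤ a ⬝ᵥ z j + h j := by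
  simp [contact]

theorem contact_nonempty [Nonempty ι] (z : ι → Plane) (h : ι → ℝ) (a : Plane) :
    (contact z h a).Nonempty := by
  obtain ⟨i, hi⟩ := Finite.exists_min fun i => a ⬝ᵥ z i + h i
  exact ⟨i, mem_contact.2 hi⟩

/-- A small tilt in direction `b` keeps only the part of the contact set where `b` is minimal:
finitely many strict inequalities against the other indices survive. -/
theorem exists_pos_contact_add_smul (z : ι → Plane) (h : ι → ℝ) (a b : Plane) :
    ∃ ε > (0 : ℝ), ∀ i, i ∈ contact z h (a + ε • b) ↔
      i ∈ contact z h a ∧ ∀ j ∈ contact z h a, b ⬝ᵥ z i ≤ b ⬝ᵥ z j := by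
  rcases isEmpty_or_nonempty ι with hι | hι
  · exact ⟨1, one_pos, fun i => hι.elim i⟩
  have hev : ∀ᶠ ε in 𝓝[>] (0 : ℝ), ∀ i j, i ∈ contact z h a → j ∉ contact z h a →
      a ⬝ᵥ z i + h i + ε * (b ⬝ᵥ z i) < a ⬝ᵥ z j + h j + ε * (b ⬝ᵥ z j) := by
    refine eventually_all.2 fun i => eventually_all.2 fun j => ?_
    by_cases hi : i ∈ contact z h a
    swap
    · exact .of_forall fun _ h => absurd h hi
    by_cases hj : j ∈ contact z h a
    · exact .of_forall fun _ _ h => absurd hj h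
    have hlt : a ⬝ᵥ z i + h i < a ⬝ᵥ z j + h j := by
      by_contra! hle
      exact hj (mem_contact.2 fun k => hle.trans (mem_contact.1 hi k))
    have : ∀ᶠ ε in 𝓝 (0 : ℝ),
        a ⬝ᵥ z i + h i + ε * (b ⬝ᵥ z i) < a ⬝ᵥ z j + h j + ε * (b ⬝ᵥ z j) := by
      refine ContinuousAt.eventually_lt (by fun_prop) (by fun_prop) (by simpa using hlt)
    exact (this.filter_mono nhdsWithin_le_nhds).mono fun _ h _ _ => h
  obtain ⟨ε, hε, hε0⟩ := (hev.and self_mem_nhdsWithin).exists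
  have hε0 : 0 < ε := hε0
  refine ⟨ε, hε0, fun i => ?_⟩
  have key : ∀ k, (a + ε • b) ⬝ᵥ z k + h k = a ⬝ᵥ z k + h k + ε * (b ⬝ᵥ z k) := fun k => by
    rw [add_dotProduct, smul_dotProduct, smul_eq_mul]; ring
  have heq : ∀ k ∈ contact z h a, ∀ l ∈ contact z h a, a ⬝ᵥ z k + h k = a ⬝ᵥ z l + h l :=
    fun k hk l hl => le_antisymm (mem_contact.1 hk l) (mem_contact.1 hl k)
  constructor
  · intro hi
    rw [mem_contact] at hi
    simp only [key] at hi
    have hia : i ∈ contact z h a := by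
      by_contra hia
      obtain ⟨k, hk⟩ := contact_nonempty z h a
      exact (hε k i hk hia).not_ge (hi k)
    refine ⟨hia, fun j hj => ?_⟩
    have := hi j
    rw [heq i hia j hj] at this
    exact le_of_mul_le_mul_left (by linarith) hε0
  · rintro ⟨hi, hmin⟩
    rw [mem_contact]
    intro j
    rw [key, key]
    by_cases hj : j ∈ contact z h a
    · rw [heq i hi j hj]
      have := mul_le_mul_of_nonneg_left (hmin j hj) hε0.le
      linarith
    · exact (hε i j hi hj).le

/-- If the points of a contact set are affinely independent, then every non-empty subset of it is
again a contact set. -/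
theorem exists_contact_eq_of_subset {z : ι → Plane} {h : ι → ℝ} {a : Plane}
    (hind : AffineIndependent ℝ fun i : contact z h a => z i) {t : Finset ι}
    (ht : t ⊆ contact z h a) (hne : t.Nonempty) : ∃ a', contact z h a' = t := by
  classical
  -- A tilt that is 0 on `t` and 1 on the rest of the contact set singles out `t`.
  obtain ⟨b, c, hbc⟩ := exists_affine_interpolation hind fun i => if (i : ι) ∈ t then 0 else 1
  obtain ⟨ε, -, hε⟩ := exists_pos_contact_add_smul z h a b
  refine ⟨a + ε • b, ?_⟩
  have hval : ∀ i ∈ contact z h a, b ⬝ᵥ z i + c = if i ∈ t then 0 else 1 :=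
    fun i hi => hbc ⟨i, hi⟩
  obtain ⟨k, hk⟩ := hne
  ext i
  rw [hε]
  constructor
  · rintro ⟨hi, hmin⟩
    by_contra hit
    have h1 := hmin k (ht hk)
    have h2 := hval k (ht hk)
    have h3 := hval i hi
    simp only [hk, hit, if_true, if_false] at h2 h3
    linarith
  · intro hit
    refine ⟨ht hit, fun j hj => ?_⟩
    have h2 := hval j hj
    have h3 := hval i (ht hit)
    rw [if_pos hit] at h3
    split_ifs at h2 <;> linarith

/-- Both weights representing `x` give it the least possible lifted height, so these heights agree.
Hence the weight `w`, supported on the first contact set, has zero total excess over the second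
minimum and is supported on both. -/
theorem convexHull_contact_inter_subset (z : ι → Plane) (h : ι → ℝ) (a a' : Plane) :
    convexHull ℝ (z '' contact z h a) ∩ convexHull ℝ (z '' contact z h a') ⊆
      convexHull ℝ (z '' (contact z h a ∩ contact z h a' : Set ι)) := by
  rintro x ⟨hx, hx'⟩
  rw [mem_convexHull_image_iff] at hx hx' ⊢
  obtain ⟨w, hw0, hwF, hw1, hwx⟩ := hx
  obtain ⟨w', hw0', hwF', hw1', hwx'⟩ := hx'
  have hne : Nonempty ι := by
    by_contra! hι
    simp at hw1
  obtain ⟨k, hk⟩ := contact_nonempty z h a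
  obtain ⟨k', hk'⟩ := contact_nonempty z h a'
  have hsum : ∀ (w : ι → ℝ), ∑ i, w i = 1 → ∑ i, w i • z i = x → ∀ (a : Plane) (k : ι),
      ∑ i, w i * (a ⬝ᵥ z i + h i - (a ⬝ᵥ z k + h k)) =
        a ⬝ᵥ x + ∑ i, w i * h i - (a ⬝ᵥ z k + h k) := by
    intro w hw1 hwx a k
    simp only [mul_sub, mul_add, sum_sub_distrib, sum_add_distrib, ← sum_mul, hw1, ← hwx,
      dotProduct_sum, dotProduct_smul, smul_eq_mul, one_mul]
  have hzero : ∀ (w : ι → ℝ) (a : Plane) (k : ι), k ∈ contact z h a →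
      (∀ i, i ∉ (contact z h a : Set ι) → w i = 0) →
      ∑ i, w i * (a ⬝ᵥ z i + h i - (a ⬝ᵥ z k + h k)) = 0 := by
    intro w a k hk hw
    refine sum_eq_zero fun i _ => ?_
    by_cases hi : i ∈ contact z h a
    · rw [le_antisymm (mem_contact.1 hi k) (mem_contact.1 hk i), sub_self, mul_zero]
    · rw [hw i (by simpa using hi), zero_mul]
  have hnn : ∀ (w : ι → ℝ) (a : Plane) (k : ι), k ∈ contact z h a → (∀ i, 0 ≤ w i) →
      ∀ i, 0 ≤ w i * (a ⬝ᵥ z i + h i - (a ⬝ᵥ z k + h k)) :=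
    fun w a k hk hw i => mul_nonneg (hw i) (sub_nonneg.2 (mem_contact.1 hk i))
  have e1 := hsum w hw1 hwx a k
  have e2 := hsum w hw1 hwx a' k'
  have e3 := hsum w' hw1' hwx' a k
  have e4 := hsum w' hw1' hwx' a' k'
  rw [hzero w a k hk hwF] at e1
  rw [hzero w' a' k' hk' hwF'] at e4
  have n2 := sum_nonneg fun i (_ : i ∈ univ) => hnn w a' k' hk' hw0 i
  have n3 := sum_nonneg fun i (_ : i ∈ univ) => hnn w' a k hk hw0' i
  have hz : ∑ i, w i * (a' ⬝ᵥ z i + h i - (a' ⬝ᵥ z k' + h k')) = 0 := by linarith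
  rw [sum_eq_zero_iff_of_nonneg fun i _ => hnn w a' k' hk' hw0 i] at hz
  refine ⟨w, hw0, fun i hi => ?_, hw1, hwx⟩
  by_cases hia : i ∈ contact z h a
  swap
  · exact hwF i (by simpa using hia)
  have hia' : i ∉ contact z h a' := fun hia' => hi ⟨by simpa using hia, by simpa using hia'⟩
  rcases mul_eq_zero.1 (hz i (mem_univ i)) with h0 | h0
  · exact h0
  · refine absurd (mem_contact.2 fun j => ?_) hia'
    linarith [mem_contact.1 hk' j]

end Contact

/-! ### Contact sets cover the convex hull -/

section Cover

variable {ι : Type*} [Fintype ι]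

theorem exists_dotProduct_eq (f : Plane →L[ℝ] ℝ) : ∃ b : Plane, ∀ y, f y = b ⬝ᵥ y := by
  refine ⟨fun k => f (Pi.single k 1), fun y => ?_⟩
  conv_lhs => rw [pi_eq_sum_univ' y]
  rw [map_sum]
  refine sum_congr rfl fun i _ => ?_
  rw [map_smul, smul_eq_mul, mul_comm]

/-- The norm on `Plane` is the sup norm, so equality fails in general. -/
theorem norm_sq_le_dotProduct_self (a : Plane) : ‖a‖ ^ 2 ≤ a ⬝ᵥ a := by
  obtain ⟨i, hi⟩ := Finite.exists_max fun i => ‖a i‖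
  have h : ‖a‖ = ‖a i‖ :=
    le_antisymm ((pi_norm_le_iff_of_nonneg (norm_nonneg _)).2 hi) (norm_le_pi_norm a i)
  rw [h, Real.norm_eq_abs, sq_abs, sq]
  exact single_le_sum (f := fun i => a i * a i) (fun j _ => mul_self_nonneg _) (mem_univ i)

theorem convex_dotProduct_lt (a : Plane) (c : ℝ) : Convex ℝ {y : Plane | a ⬝ᵥ y < c} := by
  intro y hy y' hy' s t hs ht hst
  have hy : a ⬝ᵥ y < c := hy
  have hy' : a ⬝ᵥ y' < c := hy'
  change a ⬝ᵥ (s • y + t • y') < c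
  rw [dotProduct_add, dotProduct_smul, dotProduct_smul, smul_eq_mul, smul_eq_mul]
  have hc : c = s * c + t * c := by rw [← add_mul, hst, one_mul]
  rcases hs.eq_or_lt with rfl | hs
  · have : t = 1 := by linarith
    subst this; linarith
  · have h1 := mul_lt_mul_of_pos_left hy hs
    have h2 := mul_le_mul_of_nonneg_left hy'.le ht
    linarith

/-- Every interior point of the convex hull lies in the convex hull of a contact set. -/
theorem exists_mem_convexHull_contact_of_mem_interior {z : ι → Plane} (h : ι → ℝ) {x : Plane}
    (hx : x ∈ interior (convexHull ℝ (Set.range z))) :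
    ∃ a, x ∈ convexHull ℝ (z '' contact z h a) := by
  have hne : Nonempty ι := by
    by_contra! hι
    simp [Set.range_eq_empty] at hx
  obtain ⟨δ, hδ, hball⟩ := Metric.isOpen_iff.1 isOpen_interior x hx
  have hball := hball.trans interior_subset
  -- Lagrangian dual: `φ a` is the height at `x` of the highest plane of slope `-a` below all lifted
  -- points. A maximiser of `φ` is the slope sought.
  set φ : Plane → ℝ := fun a => univ.inf' univ_nonempty (fun i => a ⬝ᵥ z i + h i) - a ⬝ᵥ x with hφ
  have hφle : ∀ a i, φ a ≤ a ⬝ᵥ z i + h i - a ⬝ᵥ x := fun a i =>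
    sub_le_sub_right (inf'_le (fun i => a ⬝ᵥ z i + h i) (mem_univ i)) _
  have hφeq : ∀ a, ∀ i ∈ contact z h a, φ a = a ⬝ᵥ z i + h i - a ⬝ᵥ x := fun a i hi =>
    le_antisymm (hφle a i)
      (sub_le_sub_right (le_inf' _ _ fun j _ => mem_contact.1 hi j) _)
  have hcont : Continuous φ := by
    refine Continuous.sub (Continuous.finset_inf'_apply univ_nonempty fun i _ => ?_) ?_ <;>
    fun_prop
  obtain ⟨m, hm⟩ := Finite.exists_max h
  -- Coercivity: a ball around `x` lies in the hull, so some `z i` lies at least `δ / 2 * ‖a‖` below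
  -- `x` in direction `a`.
  have hbound : ∀ a, φ a ≤ h m + -(δ / 2 * ‖a‖) := by
    intro a
    suffices H : ∃ i, a ⬝ᵥ z i ≤ a ⬝ᵥ x - δ / 2 * ‖a‖ by
      obtain ⟨i, hi⟩ := H
      linarith [hφle a i, hm i]
    rcases eq_or_ne a 0 with rfl | ha
    · exact ⟨m, by simp⟩
    have hna : 0 < ‖a‖ := norm_pos_iff.2 ha
    by_contra! H
    have hy : x - (δ / 2 / ‖a‖) • a ∈ Metric.ball x δ := by
      rw [mem_ball_iff_norm, sub_sub_cancel_left, norm_neg, norm_smul, Real.norm_eq_abs,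
        abs_of_pos (by positivity), div_mul_cancel₀ _ hna.ne']
      linarith
    have := convexHull_min (t := {y | (-a) ⬝ᵥ y < -(a ⬝ᵥ x - δ / 2 * ‖a‖)})
      (by
        rintro _ ⟨i, rfl⟩
        change (-a) ⬝ᵥ z i < _
        rw [neg_dotProduct]
        exact neg_lt_neg (H i)) (convex_dotProduct_lt _ _) (hball hy)
    simp only [Set.mem_ofPred_eq, neg_dotProduct, neg_lt_neg_iff, dotProduct_sub, dotProduct_smul,
      smul_eq_mul] at this
    have h2 := mul_le_mul_of_nonneg_left (norm_sq_le_dotProduct_self a)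
      (show 0 ≤ δ / 2 / ‖a‖ by positivity)
    have h3 : δ / 2 / ‖a‖ * ‖a‖ ^ 2 = δ / 2 * ‖a‖ := by field_simp
    linarith
  have hlim : Tendsto φ (cocompact Plane) atBot :=
    tendsto_atBot_mono hbound (tendsto_atBot_add_const_left _ _
      (tendsto_neg_atTop_atBot.comp ((tendsto_norm_cocompact_atTop (E := Plane)).const_mul_atTop
        (by positivity : 0 < δ / 2))))
  obtain ⟨a, ha⟩ := hcont.exists_forall_ge hlim
  refine ⟨a, ?_⟩
  by_contra hxa
  obtain ⟨f, u, hfx, hfu⟩ := geometric_hahn_banach_point_closed (convex_convexHull ℝ _)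
    (Set.Finite.isClosed_convexHull ℝ ((contact z h a).finite_toSet.image z)) hxa
  obtain ⟨b, hb⟩ := exists_dotProduct_eq f
  -- Tilting along the separating direction `b` would increase `φ`.
  obtain ⟨ε, hε0, hε⟩ := exists_pos_contact_add_smul z h a b
  obtain ⟨i, hi⟩ := contact_nonempty z h (a + ε • b)
  have hia := ((hε i).1 hi).1
  have h1 := ha (a + ε • b)
  rw [hφeq _ i hi, hφeq _ i hia, add_dotProduct, add_dotProduct, smul_dotProduct, smul_dotProduct,
    smul_eq_mul, smul_eq_mul] at h1
  have h2 := hfu (z i) (subset_convexHull ℝ _ ⟨i, hia, rfl⟩)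
  rw [hb] at h2 hfx
  have := mul_lt_mul_of_pos_left (hfx.trans h2) hε0
  linarith

/-- The convex hulls of the contact sets cover the convex hull of a full-dimensional family. -/
theorem exists_mem_convexHull_contact {z : ι → Plane} (h : ι → ℝ)
    (hz : (interior (convexHull ℝ (Set.range z))).Nonempty) {x : Plane}
    (hx : x ∈ convexHull ℝ (Set.range z)) : ∃ a, x ∈ convexHull ℝ (z '' contact z h a) := by
  have hclosed : IsClosed (⋃ F ∈ Set.range (contact z h), convexHull ℝ (z '' (F : Set ι))) :=
    (Set.toFinite _).isClosed_biUnion fun F _ =>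
      Set.Finite.isClosed_convexHull ℝ (F.finite_toSet.image z)
  have hsub : interior (convexHull ℝ (Set.range z)) ⊆
      ⋃ F ∈ Set.range (contact z h), convexHull ℝ (z '' (F : Set ι)) := by
    intro y hy
    obtain ⟨a, ha⟩ := exists_mem_convexHull_contact_of_mem_interior h hy
    exact Set.mem_biUnion ⟨a, rfl⟩ ha
  have hx' := subset_closure hx
  rw [← (convex_convexHull ℝ _).closure_interior_eq_closure_of_nonempty_interior hz] at hx'
  have := closure_minimal hsub hclosed hx'
  simpa using this

end Cover

/-! ### Lower faces as contact sets -/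

section LowerFace

variable {A : Finset (Fin 2 → ℤ)}

/-- The point of the plane given by an element of the configuration. -/
abbrev pt (p : A) : Plane := toPlane p

theorem toPlane_injective : Function.Injective toPlane := by
  intro p q hpq
  ext i
  have := congrFun hpq i
  simpa [toPlane] using this

theorem pt_injective : Function.Injective (pt (A := A)) :=
  toPlane_injective.comp Subtype.val_injective

theorem range_pt : Set.range (pt (A := A)) = toPlane '' (A : Set (Fin 2 → ℤ)) := by
  ext x; simp [pt]

theorem polygon_eq_convexHull_range : polygon A = convexHull ℝ (Set.range (pt (A := A))) := by
  rw [range_pt]; rfl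

/-- The projection of a lower face is the convex hull of the corresponding contact set. -/
theorem fst_image_lowerFace [Nonempty A] (h : Height A) (a : Plane) :
    Prod.fst '' lowerFace A h a = convexHull ℝ (pt '' (contact pt h a : Set A)) := by
  have hmem : ∀ q : Plane × ℝ, q ∈ liftedHull A h ↔ ∃ w : A → ℝ, (∀ i, 0 ≤ w i) ∧
      ∑ i, w i = 1 ∧ ∑ i, w i • (pt i, h i) = q := by
    intro q
    rw [liftedHull, ← Set.image_univ, mem_convexHull_image_iff]
    simp
  obtain ⟨k, hk⟩ := contact_nonempty pt h a
  have hval : ∀ w : A → ℝ, a ⬝ᵥ (∑ i, w i • (pt i, h i)).1 + (∑ i, w i • (pt i, h i)).2 =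
      ∑ i, w i * (a ⬝ᵥ pt i + h i) := by
    intro w
    simp only [Prod.fst_sum, Prod.snd_sum, Prod.smul_fst, Prod.smul_snd, dotProduct_sum,
      dotProduct_smul, smul_eq_mul, mul_add, sum_add_distrib]
  have hdiff : ∀ w : A → ℝ, ∑ i, w i = 1 →
      ∑ i, w i * (a ⬝ᵥ pt i + h i) =
        a ⬝ᵥ pt k + h k + ∑ i, w i * (a ⬝ᵥ pt i + h i - (a ⬝ᵥ pt k + h k)) := by
    intro w hw
    simp only [mul_sub, sum_sub_distrib, ← sum_mul, hw]
    ring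
  have hnn : ∀ w : A → ℝ, (∀ i, 0 ≤ w i) → ∀ i ∈ univ,
      0 ≤ w i * (a ⬝ᵥ pt i + h i - (a ⬝ᵥ pt k + h k)) := fun w hw i _ =>
    mul_nonneg (hw i) (sub_nonneg.2 (mem_contact.1 hk i))
  ext x
  constructor
  · rintro ⟨q, ⟨hq, hmin⟩, rfl⟩
    obtain ⟨w, hw0, hw1, rfl⟩ := (hmem q).1 hq
    have h1 := hmin (pt k, h k) (subset_convexHull ℝ _ ⟨k, rfl⟩)
    rw [hval, hdiff w hw1] at h1
    have h2 : ∑ i, w i * (a ⬝ᵥ pt i + h i - (a ⬝ᵥ pt k + h k)) = 0 :=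
      le_antisymm (by linarith) (sum_nonneg (hnn w hw0))
    rw [sum_eq_zero_iff_of_nonneg (hnn w hw0)] at h2
    rw [mem_convexHull_image_iff]
    refine ⟨w, hw0, fun i hi => ?_, hw1, by simp [Prod.fst_sum]⟩
    rcases mul_eq_zero.1 (h2 i (mem_univ i)) with h0 | h0
    · exact h0
    · refine absurd (mem_coe.2 (mem_contact.2 fun j => ?_)) hi
      linarith [mem_contact.1 hk j]
  · intro hx
    obtain ⟨w, hw0, hwF, hw1, rfl⟩ := (mem_convexHull_image_iff _ _ _).1 hx
    refine ⟨∑ i, w i • (pt i, h i), ⟨(hmem _).2 ⟨w, hw0, hw1, rfl⟩, fun q hq => ?_⟩,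
      by simp [Prod.fst_sum]⟩
    obtain ⟨w', hw0', hw1', rfl⟩ := (hmem q).1 hq
    rw [hval, hval, hdiff w hw1, hdiff w' hw1']
    have h0 : ∑ i, w i * (a ⬝ᵥ pt i + h i - (a ⬝ᵥ pt k + h k)) = 0 := by
      refine sum_eq_zero fun i _ => ?_
      by_cases hi : i ∈ contact pt h a
      · rw [le_antisymm (mem_contact.1 hi k) (mem_contact.1 hk i), sub_self, mul_zero]
      · rw [hwF i (by simpa using hi), zero_mul]
    rw [h0]
    linarith [sum_nonneg (hnn w' hw0')]

end LowerFace

/-! ### Circuits around a lattice point -/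

variable {A : Finset (Fin 2 → ℤ)}

/-- There is a linear or planar circuit centred at `r` whose outer points lie in `s`. -/
def HasCircuitIn (r : A) (s : Set Plane) : Prop :=
  (∃ i j, IsLinearCircuit i j r ∧ pt i ∈ s ∧ pt j ∈ s) ∨
    ∃ i j k, IsPlanarCircuit i j k r ∧ pt i ∈ s ∧ pt j ∈ s ∧ pt k ∈ s

theorem HasCircuitIn.mono {r : A} {s t : Set Plane} (h : HasCircuitIn r s) (hst : s ⊆ t) :
    HasCircuitIn r t := by
  rcases h with ⟨i, j, h, hi, hj⟩ | ⟨i, j, k, h, hi, hj, hk⟩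
  · exact .inl ⟨i, j, h, hst hi, hst hj⟩
  · exact .inr ⟨i, j, k, h, hst hi, hst hj, hst hk⟩

/-- A positive convex combination of three affinely independent points of the plane lies in the
interior of their convex hull. -/
theorem mem_interior_convexHull_of_pos {z : Fin 3 → Plane} (hz : AffineIndependent ℝ z)
    {w : Fin 3 → ℝ} (hw0 : ∀ i, 0 < w i) (hw1 : ∑ i, w i = 1) :
    ∑ i, w i • z i ∈ interior (convexHull ℝ (Set.range z)) := by
  have htop : affineSpan ℝ (Set.range z) = ⊤ :=
    (hz.affineSpan_eq_top_iff_card_eq_finrank_add_one).2 (by simp)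
  let b : AffineBasis (Fin 3) ℝ Plane := ⟨z, hz, htop⟩
  change _ ∈ interior (convexHull ℝ (Set.range b))
  rw [b.interior_convexHull]
  intro i
  have : ∑ i, w i • z i = univ.affineCombination ℝ b w :=
    (univ.affineCombination_eq_linear_combination b w hw1).symm
  rw [this, b.coord_apply_combination_of_mem (mem_univ i) hw1]
  exact hw0 i

theorem hasCircuitIn_of_forall_mem_range {n : ℕ} {u : Fin n → A} {r : A}
    (hu : AffineIndependent ℝ fun k => pt (u k)) {w : Fin n → ℝ} (hw0 : ∀ k, 0 < w k)
    (hw1 : ∑ k, w k = 1) (hwr : ∑ k, w k • pt (u k) = pt r) (hr : ∀ k, u k ≠ r)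
    (hall : ∀ q : A, pt q ∈ convexHull ℝ (Set.range fun k => pt (u k)) →
      q = r ∨ ∃ k, u k = q) :
    HasCircuitIn r (convexHull ℝ (Set.range fun k => pt (u k))) := by
  have hinj : Function.Injective u := fun k l hkl => hu.injective (congrArg pt hkl)
  have hmem : ∀ k, pt (u k) ∈ convexHull ℝ (Set.range fun k => pt (u k)) := fun k =>
    subset_convexHull ℝ _ ⟨k, rfl⟩
  have hn : n ≤ 3 := by
    have h1 := hu.card_le_finrank_succ
    have h2 := Submodule.finrank_le (vectorSpan ℝ (Set.range fun k => pt (u k)))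
    simp only [Fintype.card_fin, Module.finrank_fintype_fun_eq_card] at h1 h2
    omega
  interval_cases n
  · simp at hw1
  · simp only [Fin.sum_univ_one] at hw1 hwr
    rw [hw1, one_smul] at hwr
    exact absurd (pt_injective hwr) (hr 0)
  · have hne : u 0 ≠ u 1 := hinj.ne (by decide)
    have hpne : pt (u 0) ≠ pt (u 1) := pt_injective.ne hne
    refine .inl ⟨u 0, u 1, ⟨hne, fun q => ⟨fun hq => ?_, ?_⟩⟩, hmem 0, hmem 1⟩
    · have hq' : pt q ∈ convexHull ℝ (Set.range fun k => pt (u k)) :=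
        (convex_convexHull ℝ _).segment_subset (hmem 0) (hmem 1) (openSegment_subset_segment _ _ _ hq)
      rcases hall q hq' with h | ⟨k, rfl⟩
      · exact h
      · exfalso
        fin_cases k
        · exact hpne (left_mem_openSegment_iff.1 hq)
        · exact hpne (right_mem_openSegment_iff.1 hq)
    · rintro rfl
      simp only [Fin.sum_univ_two] at hw1 hwr
      exact ⟨w 0, w 1, hw0 0, hw0 1, hw1, hwr⟩
  · have hrange : Set.range (fun k => pt (u k)) = {pt (u 0), pt (u 1), pt (u 2)} := by
      ext x
      simp [Fin.exists_fin_succ, eq_comm]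
    refine .inr ⟨u 0, u 1, u 2, ⟨?_, fun q hq => ?_⟩, hmem 0, hmem 1, hmem 2⟩
    · rw [← hrange]
      change pt r ∈ _
      rw [← hwr]
      exact mem_interior_convexHull_of_pos hu hw0 hw1
    · rw [← hrange] at hq
      rcases hall q hq with h | ⟨k, rfl⟩
      · exact .inr (.inr (.inr h))
      · fin_cases k <;> simp

/-- A lattice point in the convex hull of other lattice points is the centre of a circuit inside
this convex hull. -/
theorem hasCircuitIn_convexHull (r : A) (t : Finset A) (hrt : r ∉ t)
    (hr : pt r ∈ convexHull ℝ (pt '' (t : Set A))) :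
    HasCircuitIn r (convexHull ℝ (pt '' (t : Set A))) := by
  classical
  -- Induction on the number of points of `A` in the hull. Carathéodory yields a simplex around `r`;
  -- if it holds a further point `q`, a vertex is exchanged for `q`.
  induction hN : (univ.filter fun q : A => pt q ∈ convexHull ℝ (pt '' (t : Set A))).card
    using Nat.strong_induction_on generalizing t with
  | _ N ih =>
  obtain ⟨κ, hκ, z, w, hz, hind, hw0, hw1, hwr⟩ := eq_pos_convex_span_of_mem_convexHull hr
  choose u hut huz using fun k => hz ⟨k, rfl⟩
  obtain rfl : (fun k => pt (u k)) = z := funext huz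
  have hinj : Function.Injective u := fun k l hkl => hind.injective (congrArg pt hkl)
  have hur : ∀ k, u k ≠ r := fun k h => hrt (h ▸ mem_coe.1 (hut k))
  have hsub : convexHull ℝ (Set.range fun k => pt (u k)) ⊆ convexHull ℝ (pt '' (t : Set A)) :=
    convexHull_mono hz
  by_cases hall : ∀ q : A, pt q ∈ convexHull ℝ (Set.range fun k => pt (u k)) →
      q = r ∨ ∃ k, u k = q
  · let e := (Fintype.equivFin κ).symm
    have hre : (Set.range fun k => pt (u (e k))) = Set.range fun k => pt (u k) :=
      e.surjective.range_comp fun k => pt (u k)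
    have := hasCircuitIn_of_forall_mem_range (u := u ∘ e) (r := r) (w := w ∘ e)
      (hind.comp_embedding e.toEmbedding) (fun k => hw0 _)
      (by rw [← hw1]; exact e.sum_comp w)
      (by rw [← hwr]; exact e.sum_comp fun k => w k • pt (u k)) (fun k => hur _)
      (fun q hq => by
        simp only [Function.comp_apply, hre] at hq
        rcases hall q hq with h | ⟨k, hk⟩
        · exact .inl h
        · exact .inr ⟨e.symm k, by simpa using hk⟩)
    simp only [Function.comp_apply, hre] at this
    exact this.mono hsub
  push Not at hall
  obtain ⟨q, hq, hqr, hqu⟩ := hall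
  have hq' := hq
  rw [← Set.image_univ, mem_convexHull_image_iff] at hq'
  obtain ⟨v, hv0, -, hv1, hvq⟩ := hq'
  have hpos : (univ.filter fun k => 0 < v k).Nonempty := by
    by_contra! hemp
    have : ∑ k, v k ≤ 0 := sum_nonpos fun k _ => by
      by_contra! hk
      have : k ∈ univ.filter fun k => 0 < v k := by simpa using hk
      rw [hemp] at this
      simp at this
    linarith
  -- Ratio test of the simplex method: replacing `u i` by `q` keeps all the weights of `r`
  -- nonnegative.
  obtain ⟨i, hi, hmin⟩ := exists_min_image _ (fun k => w k / v k) hpos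
  have hvi : 0 < v i := by simpa using hi
  set s := w i / v i with hs
  have hs0 : 0 < s := div_pos (hw0 i) hvi
  have hsv : s * v i = w i := div_mul_cancel₀ _ hvi.ne'
  have hws : ∀ k, 0 ≤ w k - s * v k := by
    intro k
    rcases (hv0 k).eq_or_lt with h | h
    · rw [← h, mul_zero, sub_zero]; exact (hw0 k).le
    · have := hmin k (by simpa using h)
      rw [le_div_iff₀ h] at this
      linarith
  let t' : Finset A := insert q ((univ.filter fun k => k ≠ i).image u)
  have hut' : ∀ k, k ≠ i → u k ∈ t' := fun k hk =>
    mem_insert_of_mem (mem_image_of_mem u (by simpa using hk))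
  have hrt' : r ∉ t' := by
    simp only [t', mem_insert, mem_image, not_or, not_exists, not_and]
    exact ⟨hqr.symm, fun k _ => hur k⟩
  have hr' : pt r ∈ convexHull ℝ (pt '' (t' : Set A)) := by
    have hsum1 : s + ∑ k with k ≠ i, (w k - s * v k) = 1 := by
      rw [sum_filter_of_ne (fun k _ hk => by rintro rfl; rw [hsv, sub_self] at hk; exact hk rfl),
        sum_sub_distrib, ← mul_sum, hv1, hw1]
      ring
    have hsumr : s • pt q + ∑ k with k ≠ i, (w k - s * v k) • pt (u k) = pt r := by
      rw [sum_filter_of_ne (fun k _ hk => by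
        rintro rfl; rw [hsv, sub_self, zero_smul] at hk; exact hk rfl)]
      simp only [sub_smul, sum_sub_distrib, mul_smul, ← smul_sum, hvq, hwr]
      abel
    rw [← hsumr]
    have hq't : pt q ∈ convexHull ℝ (pt '' (t' : Set A)) :=
      subset_convexHull ℝ _ ⟨q, by simp [t'], rfl⟩
    -- The index `none` stands for `q`.
    have := (convex_convexHull ℝ (pt '' (t' : Set A))).sum_mem
      (t := insert none ((univ.filter fun k => k ≠ i).map Function.Embedding.some))
      (w := fun o => o.elim s fun k => w k - s * v k)
      (z := fun o => o.elim (pt q) fun k => pt (u k)) ?_ ?_ ?_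
    · rw [sum_insert (by simp), sum_map] at this
      simpa using this
    · rintro (_ | k) -
      · exact hs0.le
      · exact hws k
    · rw [sum_insert (by simp), sum_map]
      simpa using hsum1
    · rintro (_ | k) hk
      · exact hq't
      · exact subset_convexHull ℝ _ ⟨u k, mem_coe.2 (hut' k (by simpa using hk)), rfl⟩
  have hsub' : convexHull ℝ (pt '' (t' : Set A)) ⊆ convexHull ℝ (pt '' (t : Set A)) := by
    refine (convexHull_min ?_ (convex_convexHull ℝ _)).trans hsub
    rintro _ ⟨p, hp, rfl⟩
    simp only [t', coe_insert, coe_image, Set.mem_insert_iff, Set.mem_image] at hp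
    rcases hp with rfl | ⟨k, -, rfl⟩
    · exact hq
    · exact subset_convexHull ℝ _ ⟨k, rfl⟩
  -- The `i`-th barycentric coordinate is below 1 on `t'`, so `u i` leaves the hull and the count
  -- drops.
  have hui : pt (u i) ∉ convexHull ℝ (pt '' (t' : Set A)) := by
    obtain ⟨b, c, hbc⟩ := exists_affine_interpolation hind (Pi.single i 1)
    have hvi1 : v i < 1 := by
      have hle : v i ≤ 1 := hv1 ▸ single_le_sum (fun k _ => hv0 k) (mem_univ i)
      refine lt_of_le_of_ne hle fun h1 => hqu i (pt_injective ?_)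
      rw [← add_sum_erase _ _ (mem_univ i), h1] at hv1
      have h0 : ∀ k ∈ univ.erase i, v k = 0 :=
        (sum_eq_zero_iff_of_nonneg fun k _ => hv0 k).1 (by linarith)
      rw [← hvq, ← add_sum_erase _ _ (mem_univ i), h1,
        sum_eq_zero fun k hk => by rw [h0 k hk, zero_smul]]
      simp
    have hbq : b ⬝ᵥ pt q + c = v i := by
      have : ∑ k, v k * (b ⬝ᵥ pt (u k) + c) = v i := by
        simp only [hbc]
        simp [Pi.single_apply]
      rw [← this, ← hvq, dotProduct_sum]
      simp only [mul_add, sum_add_distrib, ← sum_mul, hv1, dotProduct_smul, smul_eq_mul, one_mul]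
    intro hmem
    have := convexHull_min (t := {y | b ⬝ᵥ y < 1 - c}) ?_ (convex_dotProduct_lt _ _) hmem
    · have h1 := hbc i
      rw [Pi.single_eq_same] at h1
      have h2 : b ⬝ᵥ pt (u i) < 1 - c := this
      linarith
    · rintro _ ⟨p, hp, rfl⟩
      change b ⬝ᵥ pt p < 1 - c
      simp only [t', coe_insert, coe_image, Set.mem_insert_iff, Set.mem_image, coe_filter,
        mem_univ, true_and, Set.mem_ofPred_eq] at hp
      rcases hp with rfl | ⟨k, hk, rfl⟩
      · linarith
      · have := hbc k
        rw [Pi.single_eq_of_ne hk] at this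
        linarith
  refine (ih _ ?_ t' hrt' hr' rfl).mono hsub'
  rw [← hN]
  refine card_lt_card ⟨fun p hp => ?_, fun hle => hui ?_⟩
  · simp only [mem_filter, mem_univ, true_and] at hp ⊢
    exact hsub' hp
  · have := @hle (u i) (by
      simp only [mem_filter, mem_univ, true_and]
      exact subset_convexHull ℝ _ ⟨u i, hut i, rfl⟩)
    simpa using this

/-! ### Centres of circuits are averages -/

theorem combination_mem_convexHull_triple {x y z : Plane} {a b c : ℝ} (ha : 0 ≤ a) (hb : 0 ≤ b)
    (hc : 0 ≤ c) (habc : a + b + c = 1) :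
    a • x + b • y + c • z ∈ convexHull ℝ {x, y, z} := by
  have := (convex_convexHull ℝ ({x, y, z} : Set Plane)).sum_mem (t := univ) (w := ![a, b, c])
    (z := ![x, y, z]) ?_ ?_ ?_
  · simpa [Fin.sum_univ_three] using this
  · intro i _; fin_cases i <;> simpa
  · simpa [Fin.sum_univ_three] using habc
  · intro i _; fin_cases i <;> exact subset_convexHull ℝ _ (by simp)

theorem convexHull_triple_subset_polygon (i j k : A) :
    convexHull ℝ {pt i, pt j, pt k} ⊆ polygon A := by
  rw [polygon_eq_convexHull_range]
  refine convexHull_mono ?_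
  rintro _ (rfl | rfl | rfl) <;> exact ⟨_, rfl⟩

/-- The barycentric coordinates of an interior point of a triangle, and their uniqueness. -/
theorem exists_barycentric_of_mem_interior {x y z p : Plane}
    (hp : p ∈ interior (convexHull ℝ {x, y, z})) :
    (∃ a b c : ℝ, 0 < a ∧ 0 < b ∧ 0 < c ∧ a + b + c = 1 ∧ a • x + b • y + c • z = p) ∧
      ∀ a b c : ℝ, a + b + c = 0 → a • x + b • y + c • z = 0 → a = 0 ∧ b = 0 ∧ c = 0 := by
  have hr : Set.range ![x, y, z] = {x, y, z} := by
    ext u; simp only [Matrix.range_cons, Matrix.range_empty, Set.union_empty, Set.mem_union,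
      Set.mem_singleton_iff, Set.mem_insert_iff]
  rw [← hr] at hp
  have htop := interior_convexHull_nonempty_iff_affineSpan_eq_top.1 ⟨p, hp⟩
  have hind : AffineIndependent ℝ ![x, y, z] := by
    rw [affineIndependent_iff_finrank_vectorSpan_eq ℝ _ (n := 2) (by simp),
      ← direction_affineSpan, htop, AffineSubspace.direction_top, finrank_top]
    simp
  let b : AffineBasis (Fin 3) ℝ Plane := ⟨_, hind, htop⟩
  constructor
  · change p ∈ interior (convexHull ℝ (Set.range b)) at hp
    rw [b.interior_convexHull] at hp
    refine ⟨_, _, _, hp 0, hp 1, hp 2, ?_, ?_⟩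
    · rw [← b.sum_coord_apply_eq_one p, Fin.sum_univ_three]
    · have := b.linear_combination_coord_eq_self p
      rwa [Fin.sum_univ_three] at this
  · intro a b c h0 h1
    have := affineIndependent_iff.1 hind univ ![a, b, c] (by simpa [Fin.sum_univ_three] using h0)
      (by simpa [Fin.sum_univ_three] using h1)
    exact ⟨this 0 (mem_univ _), this 1 (mem_univ _), this 2 (mem_univ _)⟩

/-- The triangle `r p q` has no lattice points besides its vertices, so `p - r` and `q - r` generate
the lattice. The coordinates of `s - r` in this basis are `-(α / γ)` and `-(β / γ)`. -/
theorem exists_int_div_eq (hA : IsLatticePolygon A) {p q s r : A}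
    (hind : ∀ a b c : ℝ, a + b + c = 0 → a • pt p + b • pt q + c • pt s = 0 →
      a = 0 ∧ b = 0 ∧ c = 0)
    (hall : ∀ x : A, pt x ∈ convexHull ℝ {pt p, pt q, pt s} → x = p ∨ x = q ∨ x = s ∨ x = r)
    {α β γ : ℝ} (hα : 0 < α) (hβ : 0 < β) (hγ : 0 < γ) (h1 : α + β + γ = 1)
    (hr : α • pt p + β • pt q + γ • pt s = pt r) : ∃ m : ℤ, α / γ = m := by
  have huniq : ∀ a b c a' b' c' : ℝ, a + b + c = 1 → a' + b' + c' = 1 →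
      a • pt p + b • pt q + c • pt s = a' • pt p + b' • pt q + c' • pt s →
      a = a' ∧ b = b' ∧ c = c' := by
    intro a b c a' b' c' h h' heq
    have := hind (a - a') (b - b') (c - c') (by linarith) (by
      rw [← sub_eq_zero] at heq
      rw [← heq]; module)
    refine ⟨?_, ?_, ?_⟩ <;> linarith [this.1, this.2.1, this.2.2]
  have hcases : ∀ (x : Fin 2 → ℤ) (f g : ℝ), 0 ≤ f → 0 ≤ g → f + g ≤ 1 →
      toPlane x = pt r + f • (pt p - pt r) + g • (pt q - pt r) →
      (f = 0 ∧ g = 0) ∨ (f = 1 ∧ g = 0) ∨ (f = 0 ∧ g = 1) := by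
    intro x f g hf hg hfg hx
    have hx' : toPlane x = (α * (1 - f - g) + f) • pt p + (β * (1 - f - g) + g) • pt q +
        (γ * (1 - f - g)) • pt s := by
      rw [hx, ← hr]; module
    have he : 0 ≤ 1 - f - g := by linarith
    have hsum : α * (1 - f - g) + f + (β * (1 - f - g) + g) + γ * (1 - f - g) = 1 := by
      linear_combination (1 - f - g) * h1
    have hmem : toPlane x ∈ convexHull ℝ {pt p, pt q, pt s} := by
      rw [hx']
      exact combination_mem_convexHull_triple (by positivity) (by positivity) (by positivity) hsum
    have hxA := hA.mem_of_mem_polygon x (convexHull_triple_subset_polygon p q s hmem)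
    rcases hall ⟨x, hxA⟩ hmem with h | h | h | h
    all_goals
      replace h : toPlane x = _ := congrArg pt h
      rw [hx'] at h
    · obtain ⟨-, h2, h3⟩ := huniq _ _ _ 1 0 0 hsum (by norm_num) (by rw [h]; module)
      have h4 : 1 - f - g = 0 := by simpa [hγ.ne'] using h3
      rw [h4] at h2
      right; left; constructor <;> linarith
    · obtain ⟨h2, -, h3⟩ := huniq _ _ _ 0 1 0 hsum (by norm_num) (by rw [h]; module)
      have h4 : 1 - f - g = 0 := by simpa [hγ.ne'] using h3
      rw [h4] at h2
      right; right; constructor <;> linarith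
    · obtain ⟨-, -, h3⟩ := huniq _ _ _ 0 0 1 hsum (by norm_num) (by rw [h]; module)
      nlinarith
    · obtain ⟨-, -, h3⟩ := huniq _ _ _ α β γ hsum h1 (by rw [h, hr])
      have h4 : f + g = 0 := by
        have : γ * (f + g) = 0 := by linarith
        simpa [hγ.ne'] using this
      left; constructor <;> linarith
  set a : ℝ := -(α / γ) with ha
  set b : ℝ := -(β / γ) with hb
  have hs : pt s = pt r + a • (pt p - pt r) + b • (pt q - pt r) := by
    have h2 : pt s = (1 / γ) • (γ • pt s) := by
      rw [smul_smul, one_div, inv_mul_cancel₀ hγ.ne', one_smul]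
    have h3 : γ • pt s = pt r - α • pt p - β • pt q := by rw [← hr]; module
    have h4 : 1 - a - b = 1 / γ := by
      rw [ha, hb]; field_simp; linarith
    have h5 : a = -(α * (1 / γ)) := by rw [ha]; ring
    have h6 : b = -(β * (1 / γ)) := by rw [hb]; ring
    rw [h2, h3]
    calc (1 / γ) • (pt r - α • pt p - β • pt q)
        = (1 / γ) • pt r + (-(α * (1 / γ))) • pt p + (-(β * (1 / γ))) • pt q := by module
      _ = (1 - a - b) • pt r + a • pt p + b • pt q := by rw [← h5, ← h6, h4]
      _ = _ := by module
  -- Removing integer parts moves `s` into the parallelogram at `r`. Either `y` or its reflection `p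
  -- + q - y` lies in the triangle `r p q`.
  let y : Fin 2 → ℤ := s.1 - ⌊a⌋ • (p.1 - r.1) - ⌊b⌋ • (q.1 - r.1)
  have hy : toPlane y = pt r + Int.fract a • (pt p - pt r) + Int.fract b • (pt q - pt r) := by
    have h2 : toPlane y = pt s - (⌊a⌋ : ℝ) • (pt p - pt r) - (⌊b⌋ : ℝ) • (pt q - pt r) := by
      ext i; simp [y, toPlane, pt]
    rw [h2, hs, Int.fract, Int.fract]
    module
  have hfa0 := Int.fract_nonneg a
  have hfb0 := Int.fract_nonneg b
  have hfa1 := Int.fract_lt_one a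
  have hfb1 := Int.fract_lt_one b
  have hfa : Int.fract a = 0 := by
    rcases le_total (Int.fract a + Int.fract b) 1 with hle | hle
    · rcases hcases y _ _ hfa0 hfb0 hle hy with h | h | h <;> linarith [h.1, h.2]
    · have hy' : toPlane (p.1 + q.1 - y) = pt r + (1 - Int.fract a) • (pt p - pt r) +
          (1 - Int.fract b) • (pt q - pt r) := by
        have h2 : toPlane (p.1 + q.1 - y) = pt p + pt q - toPlane y := by
          ext i; simp [toPlane, pt]
        rw [h2, hy]; module
      rcases hcases _ _ _ (by linarith) (by linarith) (by linarith) hy' with h | h | h <;>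
        linarith [h.1, h.2]
  refine ⟨-⌊a⌋, ?_⟩
  have := Int.floor_add_fract a
  push_cast
  linarith

theorem eq_of_div_eq_intCast {x y : ℝ} (hx : 0 < x) (hy : 0 < y) {m n : ℤ} (hm : x / y = m)
    (hn : y / x = n) : x = y := by
  have hm0 : 0 < m := by exact_mod_cast hm ▸ div_pos hx hy
  have hmn : m * n = 1 := by
    have : (m : ℝ) * n = 1 := by
      rw [← hm, ← hn]; field_simp
    exact_mod_cast this
  have h1 := Int.eq_one_or_neg_one_of_mul_eq_one hmn
  have : m = 1 := by omega
  rw [this, Int.cast_one, div_eq_one_iff_eq hy.ne'] at hm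
  exact hm

/-- The interior lattice point of a planar circuit is the barycentre of its triangle. -/
theorem IsPlanarCircuit.add_eq (hA : IsLatticePolygon A) {i j k r : A}
    (h : IsPlanarCircuit i j k r) : pt i + pt j + pt k = (3 : ℝ) • pt r ∧ i ≠ r := by
  obtain ⟨hr, hall⟩ := h
  obtain ⟨⟨α, β, γ, hα, hβ, hγ, h1, hsum⟩, hind⟩ := exists_barycentric_of_mem_interior hr
  have key : pt i + pt j + pt k = (3 : ℝ) • pt r := by
    -- Permuting the vertices makes each ratio of weights to `γ` and its inverse integral, so all
    -- weights equal 1/3.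
    obtain ⟨m₁, hm₁⟩ := exists_int_div_eq hA hind hall hα hβ hγ h1 hsum
    obtain ⟨m₂, hm₂⟩ := exists_int_div_eq hA (p := k) (q := j) (s := i) (r := r)
      (fun a b c h0 h1 => by
        obtain ⟨h2, h3, h4⟩ := hind c b a (by linarith) (by rw [← h1]; module)
        exact ⟨h4, h3, h2⟩)
      (fun x hx => by
        have : ({pt k, pt j, pt i} : Set Plane) = {pt i, pt j, pt k} := by
          ext; simp only [Set.mem_insert_iff, Set.mem_singleton_iff]; tauto
        rw [this] at hx
        have := hall x hx; tauto)
      hγ hβ hα (by linarith) (by rw [← show _ = pt r from hsum]; module)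
    obtain ⟨n₁, hn₁⟩ := exists_int_div_eq hA (p := j) (q := i) (s := k) (r := r)
      (fun a b c h0 h1 => by
        obtain ⟨h2, h3, h4⟩ := hind b a c (by linarith) (by rw [← h1]; module)
        exact ⟨h3, h2, h4⟩)
      (fun x hx => by
        have : ({pt j, pt i, pt k} : Set Plane) = {pt i, pt j, pt k} := by
          ext; simp only [Set.mem_insert_iff, Set.mem_singleton_iff]; tauto
        rw [this] at hx
        have := hall x hx; tauto)
      hβ hα hγ (by linarith) (by rw [← show _ = pt r from hsum]; module)
    obtain ⟨n₂, hn₂⟩ := exists_int_div_eq hA (p := k) (q := i) (s := j) (r := r)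
      (fun a b c h0 h1 => by
        obtain ⟨h2, h3, h4⟩ := hind b c a (by linarith) (by rw [← h1]; module)
        exact ⟨h4, h2, h3⟩)
      (fun x hx => by
        have : ({pt k, pt i, pt j} : Set Plane) = {pt i, pt j, pt k} := by
          ext; simp only [Set.mem_insert_iff, Set.mem_singleton_iff]; tauto
        rw [this] at hx
        have := hall x hx; tauto)
      hγ hα hβ (by linarith) (by rw [← show _ = pt r from hsum]; module)
    have e1 := eq_of_div_eq_intCast hα hγ hm₁ hm₂
    have e2 := eq_of_div_eq_intCast hβ hγ hn₁ hn₂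
    subst e1 e2
    have : β = 1 / 3 := by linarith
    subst this
    rw [← show _ = pt r from hsum]
    module
  refine ⟨key, ?_⟩
  rintro rfl
  obtain ⟨h2, -, -⟩ := hind (-2) 1 1 (by norm_num) (by
    have : pt k = (2 : ℝ) • pt i - pt j := by
      rw [← sub_eq_zero] at key ⊢
      rw [← key]; module
    rw [show toPlane k = pt k from rfl, this]; module)
  norm_num at h2

/-- The middle point of a linear circuit is the midpoint of its segment. -/
theorem IsLinearCircuit.add_eq (hA : IsLatticePolygon A) {i j r : A}
    (h : IsLinearCircuit i j r) : pt i + pt j = (2 : ℝ) • pt r ∧ i ≠ r := by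
  obtain ⟨hij, hall⟩ := h
  have hr := (hall r).2 rfl
  obtain ⟨α, β, hα, hβ, h1, hsum⟩ := hr
  have h2 : toPlane (i.1 + j.1 - r.1) = pt i + pt j - pt r := by
    ext k; simp [toPlane, pt]
  -- The reflection of `r` in the midpoint is a lattice point of the open segment, hence `r` itself.
  have h3 : toPlane (i.1 + j.1 - r.1) ∈ openSegment ℝ (pt i) (pt j) := by
    refine ⟨β, α, hβ, hα, by linarith, ?_⟩
    have hα' : α = 1 - β := by linarith
    rw [h2, ← show _ = pt r from hsum, hα']
    module
  have hpoly : toPlane (i.1 + j.1 - r.1) ∈ polygon A := by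
    rw [polygon_eq_convexHull_range]
    have hmem : ∀ k : A, pt k ∈ convexHull ℝ (Set.range (pt (A := A))) := fun k =>
      subset_convexHull ℝ _ ⟨k, rfl⟩
    exact (convex_convexHull ℝ _).segment_subset (hmem i) (hmem j)
      (openSegment_subset_segment _ _ _ h3)
  have h4 : (⟨_, hA.mem_of_mem_polygon _ hpoly⟩ : A) = r := (hall _).1 h3
  have h5 : pt i + pt j - pt r = pt r := h2.symm.trans (congrArg pt h4)
  refine ⟨by rw [two_smul, ← sub_eq_iff_eq_add.1 h5], ?_⟩
  rintro rfl
  exact hij (pt_injective (left_mem_openSegment_iff.1 ((hall i).2 rfl)))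

/-! ### Constraints versus vertices of the lower hull -/

theorem linearNormal_dotProduct (i j r : A) (h : Height A) :
    linearNormal i j r ⬝ᵥ h = h i + h j - 2 * h r := by
  simp [linearNormal, sub_dotProduct, add_dotProduct]

theorem planarNormal_dotProduct (i j k r : A) (h : Height A) :
    planarNormal i j k r ⬝ᵥ h = h i + h j + h k - 3 * h r := by
  simp [planarNormal, sub_dotProduct, add_dotProduct]

/-- If every point of the configuration is a vertex of the lower hull, then all constraints hold
strictly. -/
theorem constraintNormals_dotProduct_pos (hA : IsLatticePolygon A) {h : Height A}
    (hv : ∀ p : A, ∃ a, contact pt h a = {p}) {n : Height A} (hn : n ∈ constraintNormals A) :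
    0 < n ⬝ᵥ h := by
  have hle : ∀ r : A, ∃ a : Plane, (∀ q, a ⬝ᵥ pt r + h r ≤ a ⬝ᵥ pt q + h q) ∧
      ∀ q, q ≠ r → a ⬝ᵥ pt r + h r < a ⬝ᵥ pt q + h q := by
    intro r
    obtain ⟨a, ha⟩ := hv r
    have hr := mem_contact.1 (ha ▸ mem_singleton_self r : r ∈ contact pt h a)
    refine ⟨a, hr, fun q hq => ?_⟩
    by_contra! hlt
    exact hq (mem_singleton.1 (ha ▸ mem_contact.2 fun k => hlt.trans (hr k)))
  rcases hn with ⟨i, j, r, hc, rfl⟩ | ⟨i, j, k, r, hc, rfl⟩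
  · obtain ⟨hsum, hne⟩ := hc.add_eq hA
    obtain ⟨a, ha, ha'⟩ := hle r
    have h1 := congrArg (a ⬝ᵥ ·) hsum
    simp only [dotProduct_add, dotProduct_smul, smul_eq_mul] at h1
    rw [linearNormal_dotProduct]
    -- Strictness at the single outer point `i ≠ r` suffices.
    linarith [ha' i hne, ha j]
  · obtain ⟨hsum, hne⟩ := hc.add_eq hA
    obtain ⟨a, ha, ha'⟩ := hle r
    have h1 := congrArg (a ⬝ᵥ ·) hsum
    simp only [dotProduct_add, dotProduct_smul, smul_eq_mul] at h1
    rw [planarNormal_dotProduct]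
    linarith [ha' i hne, ha j, ha k]

/-- The paraboloid satisfies all constraints strictly. -/
theorem constraintNormals_dotProduct_sq_pos (hA : IsLatticePolygon A) {n : Height A}
    (hn : n ∈ constraintNormals A) : 0 < n ⬝ᵥ fun p => pt p ⬝ᵥ pt p := by
  -- Slope `-2 p` completes the square, leaving the squared distance to `p` up to a constant.
  refine constraintNormals_dotProduct_pos hA (fun p => ⟨(-2 : ℝ) • pt p, ?_⟩) hn
  have key : ∀ q : A, ((-2 : ℝ) • pt p) ⬝ᵥ pt q + pt q ⬝ᵥ pt q =
      (pt q - pt p) ⬝ᵥ (pt q - pt p) - pt p ⬝ᵥ pt p := by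
    intro q
    simp only [smul_dotProduct, sub_dotProduct, dotProduct_sub, smul_eq_mul,
      dotProduct_comm (pt q) (pt p)]
    ring
  ext q
  rw [mem_contact, mem_singleton]
  constructor
  · intro hq
    have h1 := hq p
    rw [key, key, sub_self, zero_dotProduct] at h1
    have h2 := norm_sq_le_dotProduct_self (pt q - pt p)
    have h3 : ‖pt q - pt p‖ = 0 := by
      nlinarith [norm_nonneg (pt q - pt p)]
    exact pt_injective (sub_eq_zero.1 (norm_eq_zero.1 h3))
  · rintro rfl j
    rw [key, key, sub_self, zero_dotProduct]
    have := norm_sq_le_dotProduct_self (pt j - pt q)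
    nlinarith [sq_nonneg ‖pt j - pt q‖]

/-- If all constraints hold strictly, then a contact set contains every lattice point of its convex
hull. -/
theorem mem_contact_of_mem_convexHull (hA : IsLatticePolygon A) {h : Height A}
    (hpos : ∀ n ∈ constraintNormals A, 0 < n ⬝ᵥ h) {a : Plane} {r : A}
    (hr : pt r ∈ convexHull ℝ (pt '' (contact pt h a : Set A))) : r ∈ contact pt h a := by
  classical
  obtain ⟨p, hp, hmax⟩ := exists_max_image
    (univ.filter fun q : A => pt q ∈ convexHull ℝ (pt '' (contact pt h a : Set A)))
    (fun q => a ⬝ᵥ pt q + h q) ⟨r, by simpa using hr⟩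
  simp only [mem_filter, mem_univ, true_and] at hp hmax
  by_cases hpc : p ∈ contact pt h a
  · exact mem_contact.2 fun j => (hmax r hr).trans (mem_contact.1 hpc j)
  exfalso
  rcases hasCircuitIn_convexHull p _ hpc hp with ⟨i, j, hc, hi, hj⟩ | ⟨i, j, k, hc, hi, hj, hk⟩
  · have h1 := hpos _ (.inl ⟨i, j, p, hc, rfl⟩)
    have h2 := congrArg (a ⬝ᵥ ·) (hc.add_eq hA).1
    simp only [dotProduct_add, dotProduct_smul, smul_eq_mul] at h2
    rw [linearNormal_dotProduct] at h1
    linarith [hmax i hi, hmax j hj]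
  · have h1 := hpos _ (.inr ⟨i, j, k, p, hc, rfl⟩)
    have h2 := congrArg (a ⬝ᵥ ·) (hc.add_eq hA).1
    simp only [dotProduct_add, dotProduct_smul, smul_eq_mul] at h2
    rw [planarNormal_dotProduct] at h1
    linarith [hmax i hi, hmax j hj, hmax k hk]

/-! ### Generic heights and the triangulations they generate -/

theorem IsLatticePolygon.nonempty (hA : IsLatticePolygon A) : Nonempty A := by
  by_contra! hemp
  have h := hA.affineSpan_eq_top
  rw [← range_pt, Set.range_eq_empty] at h
  simp at h

theorem IsLatticePolygon.interior_nonempty (hA : IsLatticePolygon A) :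
    (interior (convexHull ℝ (Set.range (pt (A := A))))).Nonempty := by
  rw [interior_convexHull_nonempty_iff_affineSpan_eq_top, range_pt]
  exact hA.affineSpan_eq_top

theorem dense_setOf_dotProduct_ne_zero {ι : Type*} [Fintype ι] {μ : ι → ℝ} (hμ : μ ≠ 0) :
    Dense {h : ι → ℝ | μ ⬝ᵥ h ≠ 0} := by
  have hc : {h : ι → ℝ | μ ⬝ᵥ h ≠ 0} = ((dotProductBilin ℝ ℝ μ).ker : Set (ι → ℝ))ᶜ := by
    ext h; simp [dotProductBilin]
  rw [hc, ← interior_eq_empty_iff_dense_compl]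
  by_contra! hne
  have htop := Submodule.eq_top_of_nonempty_interior' _ hne
  have : μ ∈ (dotProductBilin ℝ ℝ μ).ker := htop ▸ Submodule.mem_top
  exact hμ (dotProduct_self_eq_zero.1 (by simpa [dotProductBilin] using this))

/-- For a generic height vector, all contact sets are affinely independent. -/
theorem dense_setOf_affineIndependent_contact {ι : Type*} [Fintype ι] (z : ι → Plane) :
    Dense {h : ι → ℝ | ∀ a, AffineIndependent ℝ fun i : contact z h a => z i} := by
  classical
  have hμ : ∀ t : {t : Finset ι // ¬ AffineIndependent ℝ fun i : t => z i},
      ∃ μ : ι → ℝ, μ ≠ 0 ∧ (∀ i, i ∉ t.1 → μ i = 0) ∧ ∑ i, μ i = 0 ∧ ∑ i, μ i • z i = 0 := by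
    rintro ⟨t, ht⟩
    rw [affineIndependent_iff_of_fintype] at ht
    push Not at ht
    obtain ⟨w, hw1, hwz, k, hk⟩ := ht
    rw [univ.weightedVSub_eq_linear_combination hw1] at hwz
    let μ : ι → ℝ := fun i => if h : i ∈ t then w ⟨i, h⟩ else 0
    have hμt : ∀ i : t, μ i = w i := fun i => by simp [μ]
    have hμn : ∀ i, i ∉ t → μ i = 0 := fun i hi => by simp [μ, hi]
    refine ⟨μ, fun h0 => hk ?_, hμn, ?_, ?_⟩
    · rw [← hμt, h0]; rfl
    · rw [← sum_subset (subset_univ t) fun i _ hi => hμn i hi, ← sum_coe_sort, ← hw1]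
      exact sum_congr rfl fun i _ => hμt i
    · rw [← sum_subset (subset_univ t) fun i _ hi => by rw [hμn i hi, zero_smul],
        ← sum_coe_sort, ← hwz]
      exact sum_congr rfl fun i _ => by rw [hμt]
  choose μ hμ0 hμt hμ1 hμz using hμ
  have hd : Dense (⋂ t, {h : ι → ℝ | μ t ⬝ᵥ h ≠ 0}) :=
    dense_iInter_of_isOpen (fun t => isOpen_ne_fun (by fun_prop) continuous_const)
      fun t => dense_setOf_dotProduct_ne_zero (hμ0 t)
  refine hd.mono fun h hh a => ?_
  by_contra hind
  refine Set.mem_iInter.1 hh ⟨_, hind⟩ ?_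
  generalize hT : (⟨contact z h a, hind⟩ :
    {t : Finset ι // ¬ AffineIndependent ℝ fun i : t => z i}) = T
  have hne : Nonempty ι := by
    by_contra! hι
    exact hμ0 T (Subsingleton.elim _ _)
  obtain ⟨k, hk⟩ := contact_nonempty z h a
  -- On a contact set `h` agrees with an affine function, so an affine dependence `μ T` supported
  -- there would annihilate `h`, which genericity excludes.
  have h1 : ∑ i, μ T i * (a ⬝ᵥ z i + h i - (a ⬝ᵥ z k + h k)) = 0 := by
    refine sum_eq_zero fun i _ => ?_
    by_cases hi : i ∈ contact z h a
    · rw [le_antisymm (mem_contact.1 hi k) (mem_contact.1 hk i), sub_self, mul_zero]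
    · rw [hμt T i (by rw [← hT]; exact hi), zero_mul]
  have h2 : ∑ i, μ T i * (a ⬝ᵥ z i) = 0 := by
    have := congrArg (a ⬝ᵥ ·) (hμz T)
    simpa only [dotProduct_sum, dotProduct_smul, smul_eq_mul, dotProduct_zero] using this
  simp only [mul_sub, mul_add, sum_sub_distrib, sum_add_distrib, ← sum_mul, hμ1, h2] at h1
  simpa [dotProduct] using h1

/-- The simplicial complex generated by a generic height vector. -/
def lowerComplex (h : Height A)
    (hind : ∀ a, AffineIndependent ℝ fun i : contact pt h a => pt i.1) [Nonempty A] :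
    Geometry.SimplicialComplex ℝ Plane where
  faces := {s | ∃ a, (s : Set Plane) = pt '' (contact pt h a : Set A)}
  isRelLowerSet_faces := by
    classical
    rintro s ⟨a, hs⟩
    refine ⟨?_, fun t hts hne => ?_⟩
    · rw [← Finset.coe_nonempty, hs]
      exact (Finset.coe_nonempty.2 (contact_nonempty pt h a)).image _
    · have ht : (t : Set Plane) = pt '' ((contact pt h a).filter fun i => pt i ∈ t : Set A) := by
        ext x
        constructor
        · intro hx
          have hxs : x ∈ (s : Set Plane) := hts hx
          rw [hs] at hxs
          obtain ⟨i, hi, rfl⟩ := hxs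
          exact ⟨i, by simpa using ⟨hi, hx⟩, rfl⟩
        · rintro ⟨i, hi, rfl⟩
          simp only [coe_filter, Set.mem_ofPred_eq] at hi
          exact hi.2
      have hne' : ((contact pt h a).filter fun i => pt i ∈ t).Nonempty := by
        rw [← Finset.coe_nonempty] at hne ⊢
        rw [ht] at hne
        exact hne.of_image
      obtain ⟨a', ha'⟩ := exists_contact_eq_of_subset (hind a) (filter_subset _ _) hne'
      exact ⟨a', by rw [ha', ht]⟩
  indep := by
    rintro s ⟨a, hs⟩
    have h1 := (hind a).range
    refine h1.mono ?_
    rw [hs]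
    rintro _ ⟨i, hi, rfl⟩
    exact ⟨⟨i, hi⟩, rfl⟩
  inter_subset_convexHull := by
    rintro s t ⟨a, hs⟩ ⟨a', ht⟩
    rw [hs, ht, ← Set.image_inter pt_injective]
    exact convexHull_contact_inter_subset pt h a a'

theorem generates_lowerComplex (h : Height A)
    (hind : ∀ a, AffineIndependent ℝ fun i : contact pt h a => pt i.1) [Nonempty A] :
    Generates A h (lowerComplex h hind) := by
  classical
  ext S
  constructor
  · rintro ⟨s, ⟨a, hs⟩, rfl⟩
    exact ⟨a, by simp only [fst_image_lowerFace, hs]⟩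
  · rintro ⟨a, rfl⟩
    exact ⟨(contact pt h a).image pt, ⟨a, by simp⟩, by simp only [fst_image_lowerFace, coe_image]⟩

theorem isFineRegularTriangulation_lowerComplex (hA : IsLatticePolygon A) {h : Height A}
    (hind : ∀ a, AffineIndependent ℝ fun i : contact pt h a => pt i.1) [Nonempty A]
    (hpos : ∀ n ∈ constraintNormals A, 0 < n ⬝ᵥ h) :
    IsFineRegularTriangulation A (lowerComplex h hind) := by
  classical
  have hcover : ∀ x ∈ polygon A, ∃ a, x ∈ convexHull ℝ (pt '' (contact pt h a : Set A)) := by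
    intro x hx
    rw [polygon_eq_convexHull_range] at hx
    exact exists_mem_convexHull_contact h hA.interior_nonempty hx
  refine ⟨⟨?_, ?_⟩, h, generates_lowerComplex h hind⟩
  · ext x
    rw [Geometry.SimplicialComplex.mem_space_iff]
    constructor
    · rintro ⟨s, ⟨a, hs⟩, hx⟩
      rw [hs] at hx
      rw [polygon_eq_convexHull_range]
      exact convexHull_mono (Set.image_subset_range _ _) hx
    · intro hx
      obtain ⟨a, ha⟩ := hcover x hx
      exact ⟨(contact pt h a).image pt, ⟨a, by simp⟩, by simpa using ha⟩
  · rw [← range_pt]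
    ext x
    rw [Geometry.SimplicialComplex.mem_vertices]
    constructor
    · rintro ⟨a, hs⟩
      have : x ∈ (({x} : Finset Plane) : Set Plane) := by simp
      rw [hs] at this
      exact Set.image_subset_range _ _ this
    · rintro ⟨p, rfl⟩
      obtain ⟨a, ha⟩ := hcover (pt p) (by
        rw [polygon_eq_convexHull_range]; exact subset_convexHull ℝ _ ⟨p, rfl⟩)
      have hp := mem_contact_of_mem_convexHull hA hpos ha
      obtain ⟨a', ha'⟩ := exists_contact_eq_of_subset (hind a)
        (singleton_subset_iff.2 hp) (singleton_nonempty p)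
      exact ⟨a', by rw [ha']; simp⟩

/-! ### The dual cone equals the support -/

/-- A height vector generating a fine triangulation satisfies all constraints strictly. -/
theorem Generates.constraintNormals_dotProduct_pos (hA : IsLatticePolygon A) {h : Height A}
    {K : Geometry.SimplicialComplex ℝ Plane} (hK : IsFineTriangulation A K)
    (hg : Generates A h K) {n : Height A} (hn : n ∈ constraintNormals A) : 0 < n ⬝ᵥ h := by
  have := hA.nonempty
  refine FineSecondary.constraintNormals_dotProduct_pos hA (fun p => ?_) hn
  have hp : pt p ∈ K.vertices := by
    rw [hK.vertices_eq, ← range_pt]; exact ⟨p, rfl⟩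
  have : convexHull ℝ (({pt p} : Finset Plane) : Set Plane) ∈
      Set.range fun a : Plane => Prod.fst '' lowerFace A h a := by
    rw [← hg]
    exact ⟨_, hp, rfl⟩
  obtain ⟨a, ha⟩ := this
  simp only [fst_image_lowerFace, coe_singleton, convexHull_singleton] at ha
  refine ⟨a, ?_⟩
  have hsub : ∀ q ∈ contact pt h a, q = p := fun q hq => by
    have : pt q ∈ convexHull ℝ (pt '' (contact pt h a : Set A)) :=
      subset_convexHull ℝ _ ⟨q, hq, rfl⟩
    rw [ha] at this
    exact pt_injective this
  exact (contact_nonempty pt h a).subset_singleton_iff.1 fun q hq => mem_singleton.2 (hsub q hq)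

/-- A complex is determined by its faces, which here are subsets of `A`. Finiteness makes the union
of closed secondary cones closed. -/
theorem finite_setOf_isFineRegularTriangulation :
    {K : Geometry.SimplicialComplex ℝ Plane | IsFineRegularTriangulation A K}.Finite := by
  classical
  refine Set.Finite.of_injOn (f := fun K : Geometry.SimplicialComplex ℝ Plane => K.faces)
    (t := Set.powerset ((A.image toPlane).powerset : Set (Finset Plane))) ?_ ?_
    (Set.Finite.powerset (Finset.finite_toSet _))
  · intro K hK s hs
    simp only [coe_powerset, Set.mem_preimage, Set.mem_powerset_iff, coe_image]
    rw [← hK.1.vertices_eq]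
    intro x hx
    exact K.down_closed hs (singleton_subset_iff.2 hx) (singleton_nonempty x)
  · intro K _ K' _ hKK'
    exact Geometry.SimplicialComplex.ext hKK'

theorem finite_constraintNormals : (constraintNormals A).Finite := by
  refine Set.Finite.subset ((Set.finite_range fun x : A × A × A => linearNormal x.1 x.2.1 x.2.2).union
    (Set.finite_range fun x : A × A × A × A => planarNormal x.1 x.2.1 x.2.2.1 x.2.2.2)) ?_
  rintro n (⟨i, j, r, -, rfl⟩ | ⟨i, j, k, r, -, rfl⟩)
  · exact .inl ⟨(i, j, r), rfl⟩
  · exact .inr ⟨(i, j, k, r), rfl⟩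

theorem isOpen_setOf_dotProduct_pos {ι : Type*} [Fintype ι] {S : Set (ι → ℝ)} (hS : S.Finite) :
    IsOpen {h : ι → ℝ | ∀ n ∈ S, 0 < n ⬝ᵥ h} := by
  have : {h : ι → ℝ | ∀ n ∈ S, 0 < n ⬝ᵥ h} = ⋂ n ∈ S, {h | 0 < n ⬝ᵥ h} := by
    ext; simp
  rw [this]
  exact hS.isOpen_biInter fun n _ => isOpen_lt continuous_const (by fun_prop)

theorem dualCone_hull (S : Set (Height A)) :
    dualCone (PointedCone.hull ℝ S : Set (Height A)) = dualCone S := by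
  refine Set.Subset.antisymm (fun h hh n hn => hh n (PointedCone.subset_hull hn)) ?_
  intro h hh n hn
  induction hn using Submodule.span_induction with
  | mem x hx => exact hh x hx
  | zero => simp
  | add x y _ _ hx hy => rw [add_dotProduct]; exact add_nonneg hx hy
  | smul c x _ hx =>
    rw [smul_dotProduct]
    exact smul_nonneg c.2 hx

/-- The constraints cut out the support of the fine secondary subfan. -/
theorem dualCone_constraintNormals (hA : IsLatticePolygon A) :
    dualCone (constraintNormals A) = fineSubfanSupport A := by
  have := hA.nonempty
  refine Set.Subset.antisymm (fun h hh => ?_) ?_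
  · have hcl : IsClosed (fineSubfanSupport A) :=
      finite_setOf_isFineRegularTriangulation.isClosed_biUnion fun K _ => isClosed_closure
    have hsub : {h : Height A | ∀ n ∈ constraintNormals A, 0 < n ⬝ᵥ h} ⊆ fineSubfanSupport A := by
      refine (Dense.open_subset_closure_inter (dense_setOf_affineIndependent_contact pt)
        (isOpen_setOf_dotProduct_pos finite_constraintNormals)).trans
        (closure_minimal ?_ hcl)
      rintro h ⟨hpos, hind⟩
      exact Set.mem_biUnion (isFineRegularTriangulation_lowerComplex hA hind hpos)
        (subset_closure (generates_lowerComplex h hind))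
    have hlim : Tendsto (fun ε : ℝ => h + ε • fun p : A => pt p ⬝ᵥ pt p) (𝓝[>] 0) (𝓝 h) := by
      have : Continuous fun ε : ℝ => h + ε • fun p : A => pt p ⬝ᵥ pt p := by fun_prop
      have := this.tendsto 0
      rw [zero_smul, add_zero] at this
      exact this.mono_left nhdsWithin_le_nhds
    refine hcl.mem_of_tendsto hlim ?_
    filter_upwards [self_mem_nhdsWithin] with ε hε
    refine hsub fun n hn => ?_
    rw [dotProduct_add, dotProduct_smul, smul_eq_mul]
    exact add_pos_of_nonneg_of_pos (hh n hn)
      (mul_pos hε (constraintNormals_dotProduct_sq_pos hA hn))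
  · refine Set.iUnion₂_subset fun K hK => closure_minimal ?_ ?_
    · intro h hg n hn
      exact (hg.constraintNormals_dotProduct_pos hA hK.1 hn).le
    · have : dualCone (constraintNormals A) = ⋂ n ∈ constraintNormals A, {h | 0 ≤ n ⬝ᵥ h} := by
        ext; simp [dualCone]
      rw [this]
      exact isClosed_biInter fun n _ => isClosed_le continuous_const (by fun_prop)

/-! ### Recovering the conical hull from its dual -/

/-- The bipolar theorem for finitely generated cones whose dual cone is full-dimensional. -/
theorem mem_hull_of_forall_dualCone {S : Set (Height A)} (hS : S.Finite) {g : Height A}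
    (hg : g ∈ interior (dualCone S)) {x : Height A} (hx : ∀ h ∈ dualCone S, 0 ≤ x ⬝ᵥ h) :
    x ∈ PointedCone.hull ℝ S := by
  -- Since `g` is interior, `g - ε • y` stays in the dual cone, so `y ⬝ᵥ g ≥ ε * (y ⬝ᵥ y)`.
  have hpos : ∀ y : Height A, y ≠ 0 → (∀ h ∈ dualCone S, 0 ≤ y ⬝ᵥ h) → 0 < y ⬝ᵥ g := by
    intro y hy hyS
    have hlim : Tendsto (fun ε : ℝ => g - ε • y) (𝓝[>] 0) (𝓝 g) := by
      have : Continuous fun ε : ℝ => g - ε • y := by fun_prop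
      have := this.tendsto 0
      rw [zero_smul, sub_zero] at this
      exact this.mono_left nhdsWithin_le_nhds
    obtain ⟨ε, hε, hε0⟩ := ((hlim.eventually (mem_interior_iff_mem_nhds.1 hg)).and
      self_mem_nhdsWithin).exists
    have hε0 : 0 < ε := hε0
    have h1 := hyS _ hε
    rw [dotProduct_sub, dotProduct_smul, smul_eq_mul] at h1
    have h2 : 0 < y ⬝ᵥ y := lt_of_le_of_ne
      (sum_nonneg fun i _ => mul_self_nonneg _) fun h => hy (dotProduct_self_eq_zero.1 h.symm)
    linarith [mul_pos hε0 h2]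
  rcases eq_or_ne x 0 with rfl | hx0
  · exact zero_mem _
  have hxg := hpos x hx0 hx
  -- Slicing the cone by the hyperplane on which `g` takes the value 1 turns it into a polytope,
  -- which is closed and can be separated from a point.
  set T : Set (Height A) := (fun n => (n ⬝ᵥ g)⁻¹ • n) '' (S \ {0}) with hT
  have hTS : convexHull ℝ T ⊆ PointedCone.hull ℝ S := by
    refine convexHull_min ?_ (PointedCone.convex _)
    rintro _ ⟨n, ⟨hn, hn0⟩, rfl⟩
    exact PointedCone.smul_mem _ (inv_nonneg.2 (hpos n hn0 fun h hh => hh n hn).le)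
      (PointedCone.subset_hull hn)
  by_cases hxT : (x ⬝ᵥ g)⁻¹ • x ∈ convexHull ℝ T
  · have := PointedCone.smul_mem (PointedCone.hull ℝ S) hxg.le (hTS hxT)
    rwa [smul_smul, mul_inv_cancel₀ hxg.ne', one_smul] at this
  exfalso
  obtain ⟨f, u, hfx, hfu⟩ := geometric_hahn_banach_point_closed (convex_convexHull ℝ _)
    (Set.Finite.isClosed_convexHull ℝ (hS.sdiff.image _)) hxT
  obtain ⟨b, hb⟩ : ∃ b : Height A, ∀ y, f y = y ⬝ᵥ b := by
    refine ⟨fun k => f (Pi.single k 1), fun y => ?_⟩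
    conv_lhs => rw [pi_eq_sum_univ' y]
    rw [map_sum]
    refine sum_congr rfl fun i _ => ?_
    rw [map_smul, smul_eq_mul]
  -- On the slice `u` equals `u • g`, so the affine separation becomes a linear one by `b - u • g`.
  have hmem : b - u • g ∈ dualCone S := by
    intro n hn
    rcases eq_or_ne n 0 with rfl | hn0
    · simp
    have hng := hpos n hn0 fun h hh => hh n hn
    have h1 := hfu _ (subset_convexHull ℝ _ ⟨n, ⟨hn, hn0⟩, rfl⟩)
    simp only [hb, smul_dotProduct, smul_eq_mul] at h1
    rw [inv_mul_eq_div, lt_div_iff₀ hng] at h1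
    rw [dotProduct_sub, dotProduct_smul, smul_eq_mul]
    linarith
  have h1 := hx _ hmem
  rw [dotProduct_sub, dotProduct_smul, smul_eq_mul] at h1
  rw [hb, smul_dotProduct, smul_eq_mul, inv_mul_eq_div, div_lt_iff₀ hxg] at hfx
  linarith

theorem hull_le_hull_of_dualCone_eq {S T : Set (Height A)} (hT : T.Finite)
    (hint : (interior (dualCone T)).Nonempty) (hST : dualCone S = dualCone T) :
    PointedCone.hull ℝ S ≤ PointedCone.hull ℝ T := by
  obtain ⟨g, hg⟩ := hint
  refine Submodule.span_le.2 fun x hx => mem_hull_of_forall_dualCone hT hg fun h hh => ?_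
  exact (hST ▸ hh : h ∈ dualCone S) x hx

theorem interior_dualCone_constraintNormals_nonempty (hA : IsLatticePolygon A) :
    (interior (dualCone (constraintNormals A))).Nonempty :=
  ⟨fun p => pt p ⬝ᵥ pt p, mem_interior.2 ⟨_, fun _ hh n hn => (hh n hn).le,
    isOpen_setOf_dotProduct_pos finite_constraintNormals,
    fun _ hn => constraintNormals_dotProduct_sq_pos hA hn⟩⟩

end FineSecondary

end

theorem mainTheorem1 (A : Finset (Fin 2 → ℤ)) (hA : FineSecondary.IsLatticePolygon A) :
    FineSecondary.dualCone
        (PointedCone.hull ℝ (FineSecondary.constraintNormals A) : Set (FineSecondary.Height A)) =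
      FineSecondary.fineSubfanSupport A ∧
    ∀ G : Set (FineSecondary.Height A), G.Finite →
      FineSecondary.dualCone (PointedCone.hull ℝ G : Set (FineSecondary.Height A)) =
        FineSecondary.fineSubfanSupport A →
      PointedCone.hull ℝ G = PointedCone.hull ℝ (FineSecondary.constraintNormals A) := by
  have hU := FineSecondary.dualCone_constraintNormals hA
  have hint := FineSecondary.interior_dualCone_constraintNormals_nonempty hA
  refine ⟨by rw [FineSecondary.dualCone_hull, hU], fun G hG hGU => ?_⟩
  rw [FineSecondary.dualCone_hull, ← hU] at hGU
  exact le_antisymm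
    (FineSecondary.hull_le_hull_of_dualCone_eq FineSecondary.finite_constraintNormals hint hGU)
    (FineSecondary.hull_le_hull_of_dualCone_eq hG (hGU ▸ hint) hGU.symm)
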